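/- Let $T$ be a nonempty string over an arbitrary alphabet $\Sigma$ (for instance a string terminated by a letter occurring nowhere else in it). The empty string $\varepsilon$ counts as occurring at all $|T|+1$ positions of $T$. A right-extension (left-extension) of a substring $w$ is a substring of $T$ of the form $wa$ ($aw$) with $a\in\Sigma$. A maximal repeat of $T$ is a substring $w$ with at least two occurrences in $T$ all of whose left- and right-extensions occur strictly fewer times in $T$ than $w$. Let $\mu_T$, $e_T^r$ and $e_T^\ell$ be the numbers of maximal repeats of $T$, of right-extensions of maximal repeats, and of left-extensions of maximal repeats, and let $\tilde e_T=e_T^r+e_T^\ell$. For substrings $x,y$ of $T$ write $x\equiv_L y$ (resp. $x\equiv_R y$) if $x$ and $y$ have the same set of beginning (resp. ending) positions in $T$. Let $\overrightarrow{x}$ be the longest string that is $\equiv_L$-equivalent to $x$ and let $[x]_R$ be the $\equiv_R$-class of $x$. The graph $\mathrm{CDAWG}(T)=(V_0,E_0)$ has nodes $V_0=\{[\overrightarrow{x}]_R : x \text{ a substring of } T\}$ and source $[\varepsilon]_R$. For every substring $x$ with $x=\overrightarrow{x}$ and every letter $a$ such that $xa$ is a substring of $T$, it has the labelled edge $([x]_R,\,a\beta,\,[xa\beta]_R)$,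 where $xa\beta=\overrightarrow{xa}$; equal triples are one edge. The graph $\text{L-CDAWG}(T)=(V,E)$ is obtained from $\mathrm{CDAWG}(T)$ as follows. For every node in $V_0$, with longest member $u$, and every letter $a$ such that $au$ is a substring of $T$, if the path from the source spelling $au$ ends strictly inside an edge, then a new node (a type-2 node) is inserted at that point, splitting the edge. If several such paths end at the same point, only one node is inserted there. After all insertions, each resulting edge with label $x\in\Sigma^+$ is stored with the first letter of $x$ and the length $|x|$. Then $V$ and $E$ are finite, and $$|V| = O(\mu_T+e_T^\ell),\qquad |E| = O(\tilde e_T),$$ where the constants in the $O$-notation are absolute, that is, independent of $T$ and of $\Sigma$. -/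

import Mathlib

namespace CDAWG

universe u

variable {A : Type u}

/-! ### Occurrences, maximal repeats and their extensions

Strings over the alphabet `A` are lists; `x <:+: T` says that `x` is a substring of `T`.
Positions are counted from `0`, and the empty string occurs at all `T.length + 1` of them. -/

/-- The beginning positions of `x` in `T`. -/
def begPos (T x : List A) : Set ℕ := {i | ∃ y z, T = y ++ x ++ z ∧ y.length = i}

/-- The ending positions of `x` in `T`. -/
def endPos (T x : List A) : Set ℕ := {j | ∃ y z, T = y ++ x ++ z ∧ (y ++ x).length = j}

theorem begPos_finite (T x : List A) : (begPos T x).Finite := by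
  refine (Set.finite_Iic T.length).subset ?_
  rintro i ⟨y, z, h, rfl⟩
  simp [h, Set.mem_Iic]

/-- The number of occurrences of `x` in `T`. -/
noncomputable def occ (T x : List A) : ℕ := (begPos T x).ncard

/-- `v` is a right-extension of `w` in `T`. -/
def IsRightExt (T w v : List A) : Prop := v <:+: T ∧ ∃ a : A, v = w ++ [a]

/-- `v` is a left-extension of `w` in `T`. -/
def IsLeftExt (T w v : List A) : Prop := v <:+: T ∧ ∃ a : A, v = a :: w

def IsRepeat (T w : List A) : Prop := w <:+: T ∧ 1 < occ T w

/-- A repeat all of whose left- and right-extensions occur strictly fewer times. -/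
def IsMaximalRepeat (T w : List A) : Prop :=
  IsRepeat T w ∧ (∀ v, IsLeftExt T w v → occ T v < occ T w) ∧
    ∀ v, IsRightExt T w v → occ T v < occ T w

/-- `μ_T`, the number of maximal repeats. -/
noncomputable def numMaxRepeats (T : List A) : ℕ := {w | IsMaximalRepeat T w}.ncard

/-- `e_T^r`, the number of right-extensions of maximal repeats. -/
noncomputable def numRightExts (T : List A) : ℕ :=
  {v | ∃ w, IsMaximalRepeat T w ∧ IsRightExt T w v}.ncard

/-- `e_T^ℓ`, the number of left-extensions of maximal repeats. -/
noncomputable def numLeftExts (T : List A) : ℕ :=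
  {v | ∃ w, IsMaximalRepeat T w ∧ IsLeftExt T w v}.ncard

/-- `ẽ_T`, the number of all extensions of maximal repeats. -/
noncomputable def numExts (T : List A) : ℕ := numRightExts T + numLeftExts T

/-! ### Edge-labelled directed graphs -/

/-- A directed graph with nodes in `N` and edges `(hi, label, lo)` labelled in `L`. -/
structure LabeledGraph (N : Type*) (L : Type*) where
  nodes : Set N
  edges : Set (N × L × N)

/-- `Path G p w q`: some path of `G` from `p` to `q` spells out `w`. -/
inductive Path {N : Type*} (G : LabeledGraph N (List A)) : N → List A → N → Prop
  | nil (p : N) (hp : p ∈ G.nodes) : Path G p [] p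
  | cons {p q r : N} {x w : List A} (he : (p, x, q) ∈ G.edges) (h : Path G q w r) :
      Path G p (x ++ w) r

/-- The path spelling out `w` from node `s` ends strictly inside the edge `e`,
after the first `k` letters of its label. -/
def EndsInside {N : Type*} (G : LabeledGraph N (List A)) (s : N) (w : List A)
    (e : N × List A × N) (k : ℕ) : Prop :=
  e ∈ G.edges ∧ 0 < k ∧ k < e.2.1.length ∧ ∃ w', Path G s w' e.1 ∧ w = w' ++ e.2.1.take k

/-! ### The compact directed acyclic word graph -/

/-- The class of `x` in the relation `≡_L` (equal beginning positions) on substrings of `T`. -/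
def classL (T x : List A) : Set (List A) := {y | y <:+: T ∧ begPos T y = begPos T x}

/-- The class of `x` in the relation `≡_R` (equal ending positions) on substrings of `T`. -/
def classR (T x : List A) : Set (List A) := {y | y <:+: T ∧ endPos T y = endPos T x}

/-- `y` is the longest member of the set `S` of strings. -/
def IsLongest (S : Set (List A)) (y : List A) : Prop := y ∈ S ∧ ∀ z ∈ S, z.length ≤ y.length

/-- `y` is the longest string that is `≡_L`-equivalent to `x`. -/
def IsLrep (T x y : List A) : Prop := IsLongest (classL T x) y

/-- `y` is the longest string that is `≡_R`-equivalent to `x`. -/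
def IsRrep (T x y : List A) : Prop := IsLongest (classR T x) y

/-- `z` is the `≡_R`-representative of the `≡_L`-representative of `x`. -/
def IsBrep (T x z : List A) : Prop := ∃ y, IsLrep T x y ∧ IsRrep T y z

/-- The equivalence `x ≡ y` of having the same two-sided representative. -/
def Equiv (T x y : List A) : Prop := ∃ z, IsBrep T x z ∧ IsBrep T y z

/-- `CDAWG(T)`. A node is the `≡_R`-class of the `≡_L`-representative `y` of a substring `x`.
For each letter `a` such that `y a` is a substring there is one edge leaving it; its label `a β`
is the one for which `y a β` is the `≡_L`-representative of `y a`, so that labels leaving a node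
start with distinct letters. -/
def cdawg (T : List A) : LabeledGraph (Set (List A)) (List A) where
  nodes := {c | ∃ x y, x <:+: T ∧ IsLrep T x y ∧ c = classR T y}
  edges := {e | ∃ (x y : List A) (a : A) (β : List A), x <:+: T ∧ IsLrep T x y ∧
    y ++ [a] <:+: T ∧ IsLrep T (y ++ [a]) (y ++ a :: β) ∧ ¬ Equiv T y (y ++ a :: β) ∧
    e = (classR T y, a :: β, classR T (y ++ a :: β))}

/-- The source of `CDAWG(T)`, the class of the empty string. -/
def source (T : List A) : Set (List A) := classR T []

/-! ### The linear-size CDAWG -/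

abbrev CdawgEdge (A : Type u) : Type u := Set (List A) × List A × Set (List A)

/-- Nodes of the linear-size CDAWG: nodes of the CDAWG (type 1) and interior points of its
edges, given by the edge and the number of letters of its label before the point (type 2). -/
inductive LNode (A : Type u) : Type u
  | type1 (c : Set (List A))
  | type2 (e : CdawgEdge A) (k : ℕ)

/-- There is a type-2 node after the first `k` letters of the edge `e`: it represents `a u`,
where `u` is the value (longest member) of a node of the CDAWG and `a u` is a substring of `T`
whose path from the source ends there, strictly inside the edge. -/
def IsType2 (T : List A) (e : CdawgEdge A) (k : ℕ) : Prop :=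
  ∃ c ∈ (cdawg T).nodes, ∃ (u : List A) (a : A), IsLongest c u ∧ a :: u <:+: T ∧
    EndsInside (cdawg T) (source T) (a :: u) e k

/-- `v` is the node that sits on the edge `e` after the first `k` letters of its label:
an end point of `e` or a type-2 node. -/
inductive OnEdge (T : List A) (e : CdawgEdge A) : ℕ → LNode A → Prop
  | hi : OnEdge T e 0 (.type1 e.1)
  | lo : OnEdge T e e.2.1.length (.type1 e.2.2)
  | mid {k : ℕ} (h : IsType2 T e k) : OnEdge T e k (.type2 e k)

/-- The CDAWG after all type-2 nodes are inserted: each edge is cut into the pieces between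
consecutive nodes on it, and each piece keeps its part of the label. -/
def splitCdawg (T : List A) : LabeledGraph (LNode A) (List A) where
  nodes := {v | (∃ c ∈ (cdawg T).nodes, v = .type1 c) ∨ ∃ e k, IsType2 T e k ∧ v = .type2 e k}
  edges := {f | ∃ e ∈ (cdawg T).edges, ∃ (i j : ℕ) (p q : LNode A), i < j ∧
    OnEdge T e i p ∧ OnEdge T e j q ∧ (∀ m v, i < m → m < j → ¬ OnEdge T e m v) ∧
    f = (p, (e.2.1.take j).drop i, q)}

/-- `L-CDAWG(T)`: the label `x` of each edge is replaced by its first letter, stored together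
with the length of `x`. -/
def lcdawg (T : List A) : LabeledGraph (LNode A) (A × ℕ) where
  nodes := (splitCdawg T).nodes
  edges := {f | ∃ (p q : LNode A) (c : A) (x : List A), (p, c :: x, q) ∈ (splitCdawg T).edges ∧
    f = (p, (c, (c :: x).length), q)}

end CDAWG

/-!
The longest member `u` of a node of the CDAWG has no extension, on either side, that occurs as
often as `u` itself. Hence `u` is a maximal repeat or it is `T`, and `T` has no extensions at all.
Nodes are thus counted by maximal repeats, up to one. An edge is determined by the node it leaves
and the first letter of its label, hence by a right-extension of the value of that node. In
particular the CDAWG is deterministic, so a string leads to at most one point inside an edge, and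
type-2 nodes are counted by left-extensions. After the insertions each edge is determined by
the point where it starts, which is the upper end of an old edge or a type-2 node.
-/

namespace CDAWG

variable {A : Type*}

theorem encard_le_encard_of_forall_subsingleton {α β : Type*} {s : Set α} {t : Set β}
    (r : α → β → Prop) (hs : ∀ a ∈ s, ∃ b ∈ t, r a b)
    (ht : ∀ b ∈ t, {a ∈ s | r a b}.Subsingleton) : s.encard ≤ t.encard := by
  choose f hft hr using hs
  refine Function.Embedding.encard_le ⟨fun a : s => ⟨f a a.2, hft a a.2⟩, fun a a' h => ?_⟩
  have hf : f a a.2 = f a' a'.2 := congrArg Subtype.val h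
  exact Subtype.ext <| ht _ (hft a a.2) ⟨a.2, hr a a.2⟩ ⟨a'.2, hf ▸ hr a' a'.2⟩

/-! ### Positions -/

theorem finite_setOf_infix (T : List A) : {x : List A | x <:+: T}.Finite :=
  T.sublists.finite_toSet.subset fun _ hx => List.mem_sublists.2 hx.sublist

theorem begPos_nonempty {T x : List A} : (begPos T x).Nonempty ↔ x <:+: T :=
  ⟨fun ⟨_, y, z, h, _⟩ => ⟨y, z, h.symm⟩, fun ⟨y, z, h⟩ => ⟨_, y, z, h.symm, rfl⟩⟩

theorem endPos_eq_image (T x : List A) : endPos T x = (· + x.length) '' begPos T x := by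
  ext j
  constructor
  · rintro ⟨y, z, h, rfl⟩
    exact ⟨y.length, ⟨y, z, h, rfl⟩, by simp⟩
  · rintro ⟨i, ⟨y, z, h, rfl⟩, rfl⟩
    exact ⟨y, z, h, by simp⟩

theorem endPos_nonempty {T x : List A} : (endPos T x).Nonempty ↔ x <:+: T := by
  rw [endPos_eq_image, Set.image_nonempty, begPos_nonempty]

theorem endPos_finite (T x : List A) : (endPos T x).Finite := by
  rw [endPos_eq_image]
  exact (begPos_finite T x).image _

theorem ncard_endPos (T x : List A) : (endPos T x).ncard = occ T x := by
  rw [endPos_eq_image, Set.ncard_image_of_injective _ (add_left_injective _), occ]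

theorem occ_pos {T x : List A} : 0 < occ T x ↔ x <:+: T := by
  rw [occ, Set.ncard_pos (begPos_finite T x), begPos_nonempty]

theorem begPos_append (T x w : List A) :
    begPos T (x ++ w) = begPos T x ∩ (· + x.length) ⁻¹' begPos T w := by
  ext i
  constructor
  · rintro ⟨y, z, h, rfl⟩
    exact ⟨⟨y, w ++ z, by simp [h], rfl⟩, y ++ x, z, by simp [h], by simp⟩
  · rintro ⟨⟨y, z, h, rfl⟩, y', z', h', hlen⟩
    have hz : z = w ++ z' := by
      rw [List.append_assoc] at h'
      exact List.append_inj_right (h.symm.trans h') (by simpa using hlen.symm)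
    exact ⟨y, z', by simp [h, hz], rfl⟩

theorem endPos_append (T x w : List A) :
    endPos T (x ++ w) = (· + w.length) '' (endPos T x ∩ begPos T w) := by
  rw [endPos_eq_image, begPos_append, endPos_eq_image T x, ← Set.image_inter_preimage,
    Set.image_image]
  simp only [List.length_append, add_assoc]

theorem begPos_append_subset (T x w : List A) : begPos T (x ++ w) ⊆ begPos T x := by
  rw [begPos_append]
  exact Set.inter_subset_left

theorem endPos_append_subset (T x w : List A) : endPos T (x ++ w) ⊆ endPos T w := by
  rw [endPos_append, endPos_eq_image T w]
  exact Set.image_mono Set.inter_subset_right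

theorem endPos_append_congr {T x y : List A} (h : endPos T x = endPos T y) (w : List A) :
    endPos T (x ++ w) = endPos T (y ++ w) := by
  rw [endPos_append, endPos_append, h]

theorem begPos_append_eq_left_iff {T x w : List A} :
    begPos T (x ++ w) = begPos T x ↔ endPos T x ⊆ begPos T w := by
  rw [begPos_append, Set.inter_eq_left, endPos_eq_image, Set.image_subset_iff]

theorem eq_of_mem_begPos {T x y : List A} {i : ℕ} (hx : i ∈ begPos T x) (hy : i ∈ begPos T y)
    (hlen : x.length = y.length) : x = y := by
  obtain ⟨p, s, h, hp⟩ := hx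
  obtain ⟨p', s', h', hp'⟩ := hy
  rw [List.append_assoc] at h h'
  exact List.append_inj_left (List.append_inj_right (h.symm.trans h') (hp.trans hp'.symm)) hlen

/-! ### Maximal repeats and representatives -/

theorem IsLeftExt.ne {T w v : List A} (h : IsLeftExt T w v) : w ≠ T := by
  rintro rfl
  obtain ⟨hv, a, rfl⟩ := h
  simpa using hv.length_le

theorem IsRightExt.ne {T w v : List A} (h : IsRightExt T w v) : w ≠ T := by
  rintro rfl
  obtain ⟨hv, a, rfl⟩ := h
  simpa using hv.length_le

theorem exists_isLeftExt_or_isRightExt {T w : List A} (hw : w <:+: T) (hne : w ≠ T) :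
    ∃ v, IsLeftExt T w v ∨ IsRightExt T w v := by
  obtain ⟨p, s, rfl⟩ := hw
  rcases p.eq_nil_or_concat with rfl | ⟨p, a, rfl⟩
  · rcases s with _ | ⟨a, s⟩
    · simp at hne
    · exact ⟨w ++ [a], .inr ⟨⟨[], s, by simp⟩, a, rfl⟩⟩
  · exact ⟨a :: w, .inl ⟨⟨p, s, by simp⟩, a, rfl⟩⟩

theorem isMaximalRepeat_of_ne {T w : List A} (hw : w <:+: T) (hne : w ≠ T)
    (hleft : ∀ v, IsLeftExt T w v → occ T v < occ T w)
    (hright : ∀ v, IsRightExt T w v → occ T v < occ T w) : IsMaximalRepeat T w := by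
  refine ⟨⟨hw, ?_⟩, hleft, hright⟩
  obtain ⟨v, hv | hv⟩ := exists_isLeftExt_or_isRightExt hw hne
  · exact (Nat.succ_le_of_lt (occ_pos.2 hv.1)).trans_lt (hleft v hv)
  · exact (Nat.succ_le_of_lt (occ_pos.2 hv.1)).trans_lt (hright v hv)

theorem occ_singleton_lt_occ_nil (T : List A) (a : A) : occ T [a] < occ T [] := by
  refine Set.ncard_lt_ncard ⟨begPos_append_subset T [] [a], fun h => ?_⟩ (begPos_finite T [])
  obtain ⟨y, z, hT, hlen⟩ : T.length ∈ begPos T [a] := h ⟨T, [], by simp, rfl⟩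
  simp [hT] at hlen

theorem isMaximalRepeat_nil {T : List A} (hT : T ≠ []) : IsMaximalRepeat T [] := by
  refine isMaximalRepeat_of_ne List.nil_infix hT.symm ?_ ?_ <;>
  · rintro _ ⟨-, a, rfl⟩
    exact occ_singleton_lt_occ_nil T a

theorem finite_setOf_isMaximalRepeat (T : List A) : {w | IsMaximalRepeat T w}.Finite :=
  (finite_setOf_infix T).subset fun _ h => h.1.1

theorem numMaxRepeats_pos {T : List A} (hT : T ≠ []) : 0 < numMaxRepeats T :=
  (Set.ncard_pos (finite_setOf_isMaximalRepeat T)).2 ⟨[], isMaximalRepeat_nil hT⟩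

theorem IsLrep.occ_lt {T x y v : List A} (h : IsLrep T x y) (hv : IsRightExt T y v) :
    occ T v < occ T y := by
  obtain ⟨hv, a, rfl⟩ := hv
  refine Set.ncard_lt_ncard ((begPos_append_subset T y [a]).ssubset_of_ne fun heq => ?_)
    (begPos_finite T y)
  simpa using h.2 (y ++ [a]) ⟨hv, heq.trans h.1.2⟩

theorem IsRrep.occ_lt {T y u v : List A} (h : IsRrep T y u) (hv : IsLeftExt T u v) :
    occ T v < occ T u := by
  obtain ⟨hv, a, rfl⟩ := hv
  rw [← ncard_endPos, ← ncard_endPos]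
  refine Set.ncard_lt_ncard ((endPos_append_subset T [a] u).ssubset_of_ne fun heq => ?_)
    (endPos_finite T u)
  simpa using h.2 (a :: u) ⟨hv, heq.trans h.1.2⟩

theorem exists_isRrep {T y : List A} (h : y <:+: T) : ∃ u, IsRrep T y u :=
  Set.exists_max_image (classR T y) List.length
    ((finite_setOf_infix T).subset fun _ hx => hx.1) ⟨y, h, rfl⟩

theorem classR_eq_of_endPos_eq {T x y : List A} (h : endPos T x = endPos T y) :
    classR T x = classR T y := by
  simp only [classR, h]

theorem infix_iff_of_endPos_eq {T x y : List A} (h : endPos T x = endPos T y) :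
    x <:+: T ↔ y <:+: T := by
  rw [← endPos_nonempty, h, endPos_nonempty]

theorem occ_eq_of_endPos_eq {T x y : List A} (h : endPos T x = endPos T y) : occ T x = occ T y := by
  rw [← ncard_endPos, h, ncard_endPos]

theorem IsBrep.isMaximalRepeat {T x u : List A} (h : IsBrep T x u) (hne : u ≠ T) :
    IsMaximalRepeat T u := by
  obtain ⟨y, hy, hu⟩ := h
  have hend : endPos T u = endPos T y := hu.1.2
  refine isMaximalRepeat_of_ne hu.1.1 hne (fun v => hu.occ_lt) ?_
  rintro _ ⟨hv, a, rfl⟩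
  have hend' : endPos T (u ++ [a]) = endPos T (y ++ [a]) := endPos_append_congr hend [a]
  rw [occ_eq_of_endPos_eq hend, occ_eq_of_endPos_eq hend']
  exact hy.occ_lt ⟨(infix_iff_of_endPos_eq hend').1 hv, a, rfl⟩

theorem IsLrep.isLongest_of_append {T y β : List A} (h : IsLrep T y (y ++ β)) :
    IsLongest {w | endPos T y ⊆ begPos T w} β := by
  refine ⟨begPos_append_eq_left_iff.1 h.1.2, fun w hw => ?_⟩
  have heq : begPos T (y ++ w) = begPos T (y ++ β) :=
    (begPos_append_eq_left_iff.2 hw).trans h.1.2.symm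
  have hyw : y ++ w <:+: T := by
    rw [← begPos_nonempty, heq, begPos_nonempty]
    exact h.1.1
  simpa using h.2 (y ++ w) ⟨hyw, heq.trans h.1.2⟩

theorem IsLrep.append_right_unique {T y y' β β' : List A} (hend : endPos T y = endPos T y')
    (h : IsLrep T y (y ++ β)) (h' : IsLrep T y' (y' ++ β')) : β = β' := by
  have hβ := h.isLongest_of_append
  have hβ' := hend ▸ h'.isLongest_of_append
  obtain ⟨j, hj⟩ := endPos_nonempty.2 ((List.infix_append_left (l₂ := β)).trans h.1.1)
  exact eq_of_mem_begPos (hβ.1 hj) (hβ'.1 hj) ((hβ'.2 β hβ.1).antisymm (hβ.2 β' hβ'.1))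

/-! ### Deterministic graphs -/

/-- A graph labelled by strings is deterministic if its labels are nonempty and the labels of
distinct edges leaving a node start with distinct letters, so that a string spells out at most
one path from a node. -/
structure LabeledGraph.IsDeterministic {N : Type*} (G : LabeledGraph N (List A)) : Prop where
  label_ne_nil : ∀ e ∈ G.edges, e.2.1 ≠ []
  eq_of_head?_eq : ∀ e ∈ G.edges, ∀ e' ∈ G.edges, e.1 = e'.1 →
    e.2.1.head? = e'.2.1.head? → e = e'

namespace EndsInside

variable {N : Type*} {G : LabeledGraph N (List A)} {e e' : N × List A × N} {k k' : ℕ}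

theorem eq_or_exists_append (hG : G.IsDeterministic) {v : List A} (he : e ∈ G.edges)
    (hhead : v.head? = e.2.1.head?) (h : EndsInside G e.1 v e' k) :
    (e' = e ∧ v = e.2.1.take k) ∨ ∃ w, v = e.2.1 ++ w ∧ EndsInside G e.2.2 w e' k := by
  obtain ⟨p, x, q⟩ := e
  obtain ⟨p', x', q'⟩ := e'
  obtain ⟨he', hk, hkl, w, hw, rfl⟩ := h
  cases hw with
  | nil =>
    rw [List.nil_append, List.head?_take, if_neg hk.ne'] at hhead
    cases hG.eq_of_head?_eq _ he' _ he rfl hhead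
    exact .inl ⟨rfl, rfl⟩
  | cons hd hw =>
    rw [List.append_assoc, List.head?_append_of_ne_nil _ (hG.label_ne_nil _ hd)] at hhead
    cases hG.eq_of_head?_eq _ hd _ he rfl hhead
    exact .inr ⟨_, List.append_assoc .., he', hk, hkl, _, hw, rfl⟩

theorem of_edge_append (hG : G.IsDeterministic) {w : List A} (he : e ∈ G.edges)
    (h : EndsInside G e.1 (e.2.1 ++ w) e' k) : EndsInside G e.2.2 w e' k := by
  have hhead : (e.2.1 ++ w).head? = e.2.1.head? :=
    List.head?_append_of_ne_nil _ (hG.label_ne_nil e he)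
  obtain ⟨rfl, htake⟩ | ⟨w', hw, h⟩ := h.eq_or_exists_append hG he hhead
  · have hlt : k < e'.2.1.length := h.2.2.1
    have hlen := congrArg List.length htake
    simp only [List.length_append, List.length_take] at hlen
    omega
  · rwa [List.append_cancel_left hw]

theorem of_edge_take (hG : G.IsDeterministic) (he : e ∈ G.edges) (hk : 0 < k)
    (hkl : k < e.2.1.length) (h : EndsInside G e.1 (e.2.1.take k) e' k') : e = e' ∧ k = k' := by
  have hhead : (e.2.1.take k).head? = e.2.1.head? := by rw [List.head?_take, if_neg hk.ne']
  obtain ⟨rfl, htake⟩ | ⟨w, hw, -⟩ := h.eq_or_exists_append hG he hhead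
  · have hkl' : k' < e'.2.1.length := h.2.2.1
    have hlen := congrArg List.length htake
    simp only [List.length_take] at hlen
    exact ⟨rfl, by omega⟩
  · have hlen := congrArg List.length hw
    simp only [List.length_take, List.length_append] at hlen
    omega

protected theorem unique (hG : G.IsDeterministic) {s : N} {v : List A}
    (h : EndsInside G s v e k) (h' : EndsInside G s v e' k') : e = e' ∧ k = k' := by
  obtain ⟨he, hk, hkl, w, hw, rfl⟩ := h
  generalize hr : e.1 = r at hw
  induction hw with
  | nil =>
    subst hr
    exact h'.of_edge_take hG he hk hkl
  | cons hd _ ih =>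
    rw [List.append_assoc] at h'
    exact ih (h'.of_edge_append hG hd) hr

end EndsInside

/-! ### The CDAWG -/

theorem exists_isBrep_of_isLongest {T : List A} {c : Set (List A)} (hc : c ∈ (cdawg T).nodes)
    {u : List A} (hu : IsLongest c u) : ∃ x, IsBrep T x u := by
  obtain ⟨x, y, -, hy, rfl⟩ := hc
  exact ⟨x, y, hy, hu⟩

theorem cdawg_nodes_encard_le (T : List A) : (cdawg T).nodes.encard ≤ numMaxRepeats T + 1 := by
  have hsub : (cdawg T).nodes ⊆ classR T '' insert T {w | IsMaximalRepeat T w} := by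
    rintro _ ⟨x, y, -, hy, rfl⟩
    obtain ⟨u, hu⟩ := exists_isRrep hy.1.1
    refine ⟨u, or_iff_not_imp_left.2 fun hne => ?_, classR_eq_of_endPos_eq hu.1.2⟩
    exact IsBrep.isMaximalRepeat ⟨y, hy, hu⟩ hne
  calc (cdawg T).nodes.encard
      ≤ (insert T {w | IsMaximalRepeat T w}).encard :=
        (Set.encard_le_encard hsub).trans (Set.encard_image_le _ _)
    _ ≤ {w | IsMaximalRepeat T w}.encard + 1 := Set.encard_insert_le _ _
    _ = numMaxRepeats T + 1 := by
        rw [numMaxRepeats, (finite_setOf_isMaximalRepeat T).cast_ncard_eq]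

theorem cdawg_isDeterministic (T : List A) : (cdawg T).IsDeterministic where
  label_ne_nil := by
    rintro _ ⟨x, y, a, β, -, -, -, -, -, rfl⟩
    exact List.cons_ne_nil a β
  eq_of_head?_eq := by
    rintro _ ⟨x, y, a, β, -, hy, -, hβ, -, rfl⟩ _ ⟨x', y', a', β', -, -, -, hβ', -, rfl⟩
      hclass hhead
    obtain rfl : a = a' := Option.some.inj hhead
    have hend : endPos T y = endPos T y' :=
      ((Set.ext_iff.1 hclass y).1 ⟨hy.1.1, rfl⟩).2
    rw [List.append_cons y a β] at hβ
    rw [List.append_cons y' a β'] at hβ'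
    obtain rfl : β = β' := hβ.append_right_unique (endPos_append_congr hend [a]) hβ'
    rw [classR_eq_of_endPos_eq hend, classR_eq_of_endPos_eq (endPos_append_congr hend (a :: β))]

theorem exists_isRightExt_of_mem_cdawg_edges {T : List A} {e : CdawgEdge A}
    (he : e ∈ (cdawg T).edges) :
    ∃ (u : List A) (a : A), IsMaximalRepeat T u ∧ IsRightExt T u (u ++ [a]) ∧
      e.1 = classR T u ∧ e.2.1.head? = some a := by
  obtain ⟨x, y, a, β, -, hy, hya, -, -, rfl⟩ := he
  obtain ⟨u, hu⟩ := exists_isRrep hy.1.1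
  have hua : IsRightExt T u (u ++ [a]) :=
    ⟨(infix_iff_of_endPos_eq (endPos_append_congr hu.1.2 [a])).2 hya, a, rfl⟩
  have hmax : IsMaximalRepeat T u := IsBrep.isMaximalRepeat ⟨y, hy, hu⟩ hua.ne
  exact ⟨u, a, hmax, hua, (classR_eq_of_endPos_eq hu.1.2).symm, rfl⟩

theorem cdawg_edges_encard_le (T : List A) : (cdawg T).edges.encard ≤ numRightExts T := by
  have hfin : {v | ∃ w, IsMaximalRepeat T w ∧ IsRightExt T w v}.Finite :=
    (finite_setOf_infix T).subset fun _ ⟨_, _, h⟩ => h.1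
  rw [numRightExts, hfin.cast_ncard_eq]
  refine encard_le_encard_of_forall_subsingleton
    (fun e v => e.1 = classR T v.dropLast ∧ e.2.1.head? = v.getLast?) (fun e he => ?_) ?_
  · obtain ⟨u, a, hmax, hua, hclass, hhead⟩ := exists_isRightExt_of_mem_cdawg_edges he
    exact ⟨u ++ [a], ⟨u, hmax, hua⟩, by simpa using hclass, by simpa using hhead⟩
  · rintro v - e ⟨he, hclass, hhead⟩ e' ⟨he', hclass', hhead'⟩
    exact (cdawg_isDeterministic T).eq_of_head?_eq e he e' he'
      (hclass.trans hclass'.symm) (hhead.trans hhead'.symm)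

/-! ### The linear-size CDAWG -/

/-- The points of the CDAWG at which a type-2 node is inserted, each given by an edge and a
number of letters of its label. -/
def type2Points (T : List A) : Set (CdawgEdge A × ℕ) := {f | IsType2 T f.1 f.2}

theorem type2Points_encard_le (T : List A) : (type2Points T).encard ≤ numLeftExts T := by
  have hfin : {v | ∃ w, IsMaximalRepeat T w ∧ IsLeftExt T w v}.Finite :=
    (finite_setOf_infix T).subset fun _ ⟨_, _, h⟩ => h.1
  rw [numLeftExts, hfin.cast_ncard_eq]
  refine encard_le_encard_of_forall_subsingleton
    (fun f v => EndsInside (cdawg T) (source T) v f.1 f.2) ?_ ?_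
  · rintro f ⟨c, hc, u, a, hu, hau, hin⟩
    obtain ⟨x, hx⟩ := exists_isBrep_of_isLongest hc hu
    have hext : IsLeftExt T u (a :: u) := ⟨hau, a, rfl⟩
    exact ⟨a :: u, ⟨u, hx.isMaximalRepeat hext.ne, hext⟩, hin⟩
  · rintro v - f ⟨-, h⟩ f' ⟨-, h'⟩
    exact Prod.ext_iff.2 (h.unique (cdawg_isDeterministic T) h')

theorem lcdawg_nodes_eq (T : List A) :
    (lcdawg T).nodes = LNode.type1 '' (cdawg T).nodes ∪
      (fun f => LNode.type2 f.1 f.2) '' type2Points T := by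
  ext p
  simp only [lcdawg, splitCdawg, type2Points, Set.mem_ofPred_eq, Set.mem_union, Set.mem_image,
    Prod.exists, eq_comm]

theorem lcdawg_nodes_encard_le (T : List A) :
    (lcdawg T).nodes.encard ≤ (numMaxRepeats T + 1 + numLeftExts T : ℕ) := by
  push_cast [lcdawg_nodes_eq]
  exact (Set.encard_union_le _ _).trans <| add_le_add
    ((Set.encard_image_le _ _).trans (cdawg_nodes_encard_le T))
    ((Set.encard_image_le _ _).trans (type2Points_encard_le T))

/-- The node at the point of the edge `e` after the first `k` letters of its label, for those `k`
at which there is one. -/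
def nodeAt (e : CdawgEdge A) (k : ℕ) : LNode A :=
  if k = 0 then .type1 e.1 else if k = e.2.1.length then .type1 e.2.2 else .type2 e k

theorem IsType2.pos_and_lt {T : List A} {e : CdawgEdge A} {k : ℕ} (h : IsType2 T e k) :
    0 < k ∧ k < e.2.1.length := by
  obtain ⟨_, -, _, _, -, -, -, hpos, hlt, -⟩ := h
  exact ⟨hpos, hlt⟩

theorem OnEdge.eq_nodeAt {T : List A} {e : CdawgEdge A} (he : e.2.1 ≠ []) {k : ℕ} {p : LNode A}
    (h : OnEdge T e k p) : p = nodeAt e k := by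
  cases h with
  | hi => simp [nodeAt]
  | lo => simp [nodeAt, he]
  | mid h => simp [nodeAt, h.pos_and_lt.1.ne', h.pos_and_lt.2.ne]

theorem OnEdge.le_length {T : List A} {e : CdawgEdge A} {k : ℕ} {p : LNode A}
    (h : OnEdge T e k p) : k ≤ e.2.1.length := by
  cases h with
  | hi => exact Nat.zero_le _
  | lo => exact le_rfl
  | mid h => exact h.pos_and_lt.2.le

/-- `f` is the piece of the edge `e` that starts after the first `i` letters of its label and
leads to the next node on `e`. -/
def IsPiece (T : List A) (e : CdawgEdge A) (i : ℕ) (f : LNode A × List A × LNode A) : Prop :=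
  ∃ (j : ℕ) (p q : LNode A), i < j ∧ OnEdge T e i p ∧ OnEdge T e j q ∧
    (∀ m v, i < m → m < j → ¬ OnEdge T e m v) ∧ f = (p, (e.2.1.take j).drop i, q)

theorem mem_splitCdawg_edges {T : List A} {f : LNode A × List A × LNode A} :
    f ∈ (splitCdawg T).edges ↔ ∃ e ∈ (cdawg T).edges, ∃ i, IsPiece T e i f :=
  Iff.rfl

theorem IsPiece.unique {T : List A} {e : CdawgEdge A} (he : e.2.1 ≠ []) {i : ℕ}
    {f f' : LNode A × List A × LNode A} (h : IsPiece T e i f) (h' : IsPiece T e i f') :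
    f = f' := by
  obtain ⟨j, p, q, hij, hp, hq, hnext, rfl⟩ := h
  obtain ⟨j', p', q', hij', hp', hq', hnext', rfl⟩ := h'
  obtain rfl : j = j' := le_antisymm
    (not_lt.1 fun hlt => hnext j' q' hij' hlt hq') (not_lt.1 fun hlt => hnext' j q hij hlt hq)
  rw [hp.eq_nodeAt he, hp'.eq_nodeAt he, hq.eq_nodeAt he, hq'.eq_nodeAt he]

theorem IsPiece.eq_zero_or_isType2 {T : List A} {e : CdawgEdge A} {i : ℕ}
    {f : LNode A × List A × LNode A} (h : IsPiece T e i f) : i = 0 ∨ IsType2 T e i := by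
  obtain ⟨j, p, q, hij, hp, hq, -, -⟩ := h
  cases hp with
  | hi => exact .inl rfl
  | lo => exact absurd hq.le_length hij.not_ge
  | mid h => exact .inr h

theorem splitCdawg_edges_encard_le (T : List A) :
    (splitCdawg T).edges.encard ≤ (cdawg T).edges.encard + (type2Points T).encard := by
  let starts : Set (CdawgEdge A × ℕ) := (fun e => (e, 0)) '' (cdawg T).edges ∪ type2Points T
  calc (splitCdawg T).edges.encard
      ≤ starts.encard := by
        refine encard_le_encard_of_forall_subsingleton
          (fun f t => t.1 ∈ (cdawg T).edges ∧ IsPiece T t.1 t.2 f) (fun f hf => ?_) ?_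
        · obtain ⟨e, he, i, hpiece⟩ := mem_splitCdawg_edges.1 hf
          refine ⟨(e, i), ?_, he, hpiece⟩
          obtain rfl | htype2 := hpiece.eq_zero_or_isType2
          · exact .inl ⟨e, he, rfl⟩
          · exact .inr htype2
        · rintro t - f ⟨-, he, hpiece⟩ f' ⟨-, -, hpiece'⟩
          exact hpiece.unique ((cdawg_isDeterministic T).label_ne_nil _ he) hpiece'
    _ ≤ ((fun e => (e, 0)) '' (cdawg T).edges).encard + (type2Points T).encard :=
        Set.encard_union_le _ _
    _ ≤ (cdawg T).edges.encard + (type2Points T).encard := by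
        gcongr
        exact Set.encard_image_le _ _

theorem lcdawg_edges_encard_le_splitCdawg (T : List A) :
    (lcdawg T).edges.encard ≤ (splitCdawg T).edges.encard := by
  refine encard_le_encard_of_forall_subsingleton
    (fun f g => ∃ c x, g.2.1 = c :: x ∧ f = (g.1, (c, (c :: x).length), g.2.2)) ?_ ?_
  · rintro _ ⟨p, q, c, x, hg, rfl⟩
    exact ⟨(p, c :: x, q), hg, c, x, rfl, rfl⟩
  · rintro g - _ ⟨-, c, x, hx, rfl⟩ _ ⟨-, c', x', hx', rfl⟩
    obtain ⟨rfl, rfl⟩ := List.cons.inj (hx.symm.trans hx')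
    rfl

theorem lcdawg_edges_encard_le (T : List A) : (lcdawg T).edges.encard ≤ numExts T := by
  rw [numExts, Nat.cast_add]
  calc (lcdawg T).edges.encard
      ≤ (cdawg T).edges.encard + (type2Points T).encard :=
        (lcdawg_edges_encard_le_splitCdawg T).trans (splitCdawg_edges_encard_le T)
    _ ≤ numRightExts T + numLeftExts T :=
        add_le_add (cdawg_edges_encard_le T) (type2Points_encard_le T)

end CDAWG

theorem mainTheorem2 :
    ∃ C : ℕ, ∀ (A : Type*) (T : List A), T ≠ [] →
      ((CDAWG.lcdawg T).nodes.Finite ∧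
        (CDAWG.lcdawg T).nodes.ncard ≤ C * (CDAWG.numMaxRepeats T + CDAWG.numLeftExts T)) ∧
      ((CDAWG.lcdawg T).edges.Finite ∧
        (CDAWG.lcdawg T).edges.ncard ≤ C * CDAWG.numExts T) := by
  refine ⟨2, fun A T hT => ?_⟩
  obtain ⟨hV, hV'⟩ := Set.encard_le_coe_iff_finite_ncard_le.1 <| CDAWG.lcdawg_nodes_encard_le T
  obtain ⟨hE, hE'⟩ := Set.encard_le_coe_iff_finite_ncard_le.1 <| CDAWG.lcdawg_edges_encard_le T
  have hμ := CDAWG.numMaxRepeats_pos hT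
  exact ⟨⟨hV, by omega⟩, hE, by omega⟩
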